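/- Let $E$ be a Polish space, let $p\in(1,\infty)$ and $q=p/(p-1)$, let $\mu$ be a Borel probability measure on $E$, and let $\psi:E\to[0,\infty)$ be continuous with $\int_E\psi^q\,d\mu<\infty$. Let $\mathcal P_\psi(E)$ be the set of Borel probability measures $\nu$ on $E$ with $\int_E\psi\,d\nu<\infty$, equipped with the coarsest topology for which $\nu\mapsto\int_E f\,d\nu$ is continuous for every continuous $f:E\to\mathbb R$ with $|f|\le 1+\psi$. For $n\ge1$ let $\mu^n$ be the $n$-fold product measure on $E^n$, and let $L_n:E^n\to\mathcal P_\psi(E)$, $L_n(x_1,\dots,x_n)=\frac1n\sum_{i=1}^n\delta_{x_i}$, be the empirical measure. Set $\|d\nu/d\mu\|_{L^p(\mu)}=\left(\int_E (d\nu/d\mu)^p\,d\mu\right)^{1/p}\in[1,\infty]$ if $\nu\ll\mu$, and $\|d\nu/d\mu\|_{L^p(\mu)}=\infty$ otherwise. Then, for every closed set $A\subset\mathcal P_\psi(E)$, $$\limsup_{n\to\infty}\ n^{1/p}\,\mu^n(L_n\in A)^{1/q}\ \le\ \left(\inf_{\nu\in A}\|d\nu/d\mu\|_{L^p(\mu)}-1\right)^{-1},$$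 with the conventions $\inf\emptyset=\infty$, $\infty-1=\infty$, $0^{-1}=\infty$ and $\infty^{-1}=0$. -/

import Mathlib

open MeasureTheory Filter Topology
open scoped NNReal ENNReal

namespace HeavySanov

variable {E : Type*} [MeasurableSpace E]

/-- The set `P_ψ(E)` of Borel probability measures `ν` on `E` with `∫ ψ dν < ∞`, as a type. -/
def PsiProb (ψ : E → ℝ≥0) : Type _ :=
  {ν : ProbabilityMeasure E // ∫⁻ x, (ψ x : ℝ≥0∞) ∂(ν : Measure E) < ∞}

/-- The measure underlying an element of `P_ψ(E)`. -/
def PsiProb.toMeasure {ψ : E → ℝ≥0} (ν : PsiProb ψ) : Measure E := (ν.1 : Measure E)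

/-- The test functions of the `ψ`-weak topology: continuous `f : E → ℝ` with `|f| ≤ 1 + ψ`. -/
def PsiTest {E : Type*} [TopologicalSpace E] (ψ : E → ℝ≥0) : Type _ :=
  {f : E → ℝ // Continuous f ∧ ∀ x, |f x| ≤ 1 + (ψ x : ℝ)}

/-- The `ψ`-weak topology on `P_ψ(E)`: the coarsest topology which makes `ν ↦ ∫ f dν`
continuous for every continuous `f : E → ℝ` with `|f| ≤ 1 + ψ`. -/
noncomputable instance PsiProb.instTopologicalSpace [TopologicalSpace E] (ψ : E → ℝ≥0) : TopologicalSpace (PsiProb ψ) :=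
  ⨅ f : PsiTest ψ, TopologicalSpace.induced
    (fun ν : PsiProb ψ => ∫ x, f.1 x ∂ν.toMeasure) inferInstance

/-- The empirical measure `(1/n) ∑ i, δ_{x i}`. -/
noncomputable def empiricalMeasure (n : ℕ) (x : Fin n → E) : Measure E :=
  (n : ℝ≥0∞)⁻¹ • ∑ i, Measure.dirac (x i)

theorem isProbabilityMeasure_empiricalMeasure (n : ℕ) [NeZero n] (x : Fin n → E) :
    IsProbabilityMeasure (empiricalMeasure n x) := by
  refine ⟨?_⟩
  have hn : (n : ℝ≥0∞) ≠ 0 := by exact_mod_cast NeZero.ne n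
  simp [empiricalMeasure, ENNReal.inv_mul_cancel hn (ENNReal.natCast_ne_top n)]

theorem lintegral_empiricalMeasure_lt_top [TopologicalSpace E] [BorelSpace E] {ψ : E → ℝ≥0} (hψ : Continuous ψ)
    (n : ℕ) [NeZero n] (x : Fin n → E) :
    ∫⁻ y, (ψ y : ℝ≥0∞) ∂(empiricalMeasure n x) < ∞ := by
  have hm : Measurable fun y => (ψ y : ℝ≥0∞) := hψ.measurable.coe_nnreal_ennreal
  have hn : (n : ℝ≥0∞) ≠ 0 := by exact_mod_cast NeZero.ne n
  simp only [empiricalMeasure, lintegral_smul_measure, lintegral_finsetSum_measure,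
    lintegral_dirac' _ hm, smul_eq_mul]
  exact ENNReal.mul_lt_top (ENNReal.inv_lt_top.2 (pos_iff_ne_zero.2 hn))
    (ENNReal.sum_lt_top.2 fun i _ => ENNReal.coe_lt_top)

/-- The empirical measure map `L_n : E^n → P_ψ(E)`, for `n ≥ 1` and continuous `ψ`. -/
noncomputable def L [TopologicalSpace E] [BorelSpace E] {ψ : E → ℝ≥0} (hψ : Continuous ψ)
    (n : ℕ) [NeZero n] (x : Fin n → E) : PsiProb ψ :=
  ⟨⟨empiricalMeasure n x, isProbabilityMeasure_empiricalMeasure n x⟩,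
    lintegral_empiricalMeasure_lt_top hψ n x⟩

open Classical in
/-- The norm `‖dν/dμ‖_{L^p(μ)} ∈ [0, ∞]` for `ν ≪ μ`, and `∞` if `ν` is not absolutely
continuous with respect to `μ`. -/
noncomputable def densityNorm (p : ℝ) (ν μ : Measure E) : ℝ≥0∞ :=
  if ν ≪ μ then eLpNorm (ν.rnDeriv μ) (ENNReal.ofReal p) μ else ∞

end HeavySanov

namespace HeavySanov

theorem exp_le_one_add_add_abs_rpow_mul_exp {r y b : ℝ} (hr1 : 1 ≤ r) (hr2 : r ≤ 2)
    (hyb : y ≤ b) (hb : 0 ≤ b) : Real.exp y ≤ 1 + y + |y| ^ r * Real.exp b := by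
  have hexp : 1 ≤ Real.exp b := Real.one_le_exp hb
  have hle : |y| ^ r ≤ |y| ^ r * Real.exp b :=
    le_mul_of_one_le_right (Real.rpow_nonneg (abs_nonneg y) r) hexp
  rcases le_or_gt |y| 1 with h | h
  · have h1 := (abs_le.1 (Real.abs_exp_sub_one_sub_id_le h)).2
    have h2 : y ^ 2 ≤ |y| ^ r := by
      rw [← sq_abs, ← Real.rpow_natCast]
      rcases (abs_nonneg y).eq_or_lt with h0 | h0
      · rw [← h0, Real.zero_rpow (by norm_num), Real.zero_rpow (by linarith)]
      · exact Real.rpow_le_rpow_of_exponent_ge h0 h (by simpa using hr2)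
    linarith
  · have h1 : |y| ≤ |y| ^ r := by
      simpa using Real.rpow_le_rpow_of_exponent_le h.le hr1
    rcases le_or_gt 0 y with h0 | h0
    · have : Real.exp b ≤ |y| ^ r * Real.exp b :=
        le_mul_of_one_le_left (Real.exp_pos b).le (h.le.trans h1)
      linarith [Real.exp_le_exp.2 hyb]
    · have : Real.exp y ≤ 1 := Real.exp_le_one_iff.2 h0.le
      linarith [neg_le_abs y]

section

variable {E : Type*} [MeasurableSpace E] {μ : Measure E} [IsProbabilityMeasure μ] {f : E → ℝ}

theorem integrable_exp_mul_min (hf : Measurable f) {l : ℝ} (hl : 0 ≤ l) (a : ℝ) :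
    Integrable (fun x => Real.exp (l * min (f x) a)) μ := by
  refine Integrable.of_bound (C := Real.exp (l * a)) (by fun_prop) (ae_of_all _ fun x => ?_)
  rw [Real.norm_eq_abs, Real.abs_exp]
  gcongr
  exact min_le_right _ _

theorem integral_exp_mul_min_le {r l a : ℝ} (hr1 : 1 ≤ r) (hr2 : r ≤ 2) (hf : Measurable f)
    (hfi : Integrable f μ) (hfr : Integrable (fun x => |f x| ^ r) μ) (hl : 0 ≤ l) (ha : 0 ≤ a) :
    ∫ x, Real.exp (l * min (f x) a) ∂μ
      ≤ Real.exp (l * ∫ x, f x ∂μ + l ^ r * Real.exp (l * a) * ∫ x, |f x| ^ r ∂μ) := by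
  have hpt : ∀ x, Real.exp (l * min (f x) a)
      ≤ (1 + l * f x) + l ^ r * Real.exp (l * a) * |f x| ^ r := fun x => by
    have h1 := exp_le_one_add_add_abs_rpow_mul_exp (y := l * min (f x) a) hr1 hr2
      (mul_le_mul_of_nonneg_left (min_le_right (f x) a) hl) (mul_nonneg hl ha)
    have h2 : |min (f x) a| ≤ |f x| := by
      rcases le_total (f x) a with h | h
      · rw [min_eq_left h]
      · rw [min_eq_right h, abs_of_nonneg ha]
        exact h.trans (le_abs_self _)
    have h3 : |l * min (f x) a| ^ r ≤ l ^ r * |f x| ^ r := by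
      rw [abs_mul, abs_of_nonneg hl, Real.mul_rpow hl (abs_nonneg _)]
      gcongr
    have h4 : l * min (f x) a ≤ l * f x := mul_le_mul_of_nonneg_left (min_le_left _ _) hl
    have h5 := mul_le_mul_of_nonneg_right h3 (Real.exp_pos (l * a)).le
    linarith
  have hi1 : Integrable (fun x => 1 + l * f x) μ := (integrable_const _).add (hfi.const_mul l)
  have hi2 := hfr.const_mul (l ^ r * Real.exp (l * a))
  calc ∫ x, Real.exp (l * min (f x) a) ∂μ
      ≤ ∫ x, (1 + l * f x) + l ^ r * Real.exp (l * a) * |f x| ^ r ∂μ :=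
        integral_mono (integrable_exp_mul_min hf hl a) (hi1.add hi2) hpt
    _ = (l * ∫ x, f x ∂μ + l ^ r * Real.exp (l * a) * ∫ x, |f x| ^ r ∂μ) + 1 := by
        rw [integral_add hi1 hi2, integral_add (integrable_const _) (hfi.const_mul l),
          integral_const_mul, integral_const_mul]
        simp
        ring
    _ ≤ _ := Real.add_one_le_exp _

theorem pi_sum_ge_le {r l a ε : ℝ} (hr1 : 1 ≤ r) (hr2 : r ≤ 2) (hf : Measurable f)
    (hfi : Integrable f μ) (hfr : Integrable (fun x => |f x| ^ r) μ) (hl : 0 ≤ l) (ha : 0 ≤ a)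
    (n : ℕ) :
    Measure.pi (fun _ : Fin n => μ) {x | n * ((∫ y, f y ∂μ) + ε) ≤ ∑ i, f (x i)}
      ≤ n * μ {y | a < f y} + ENNReal.ofReal
        (Real.exp (n * (l ^ r * Real.exp (l * a) * ∫ x, |f x| ^ r ∂μ) - l * n * ε)) := by
  set P := Measure.pi (fun _ : Fin n => μ)
  set m := ∫ y, f y ∂μ
  set C := ∫ x, |f x| ^ r ∂μ
  have hsub : {x : Fin n → E | n * (m + ε) ≤ ∑ i, f (x i)}
      ⊆ (⋃ i, Function.eval i ⁻¹' {y | a < f y}) ∪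
        {x | Real.exp (l * (n * (m + ε))) ≤ ∏ i, Real.exp (l * min (f (x i)) a)} := by
    intro x hx
    by_cases h : ∃ i, a < f (x i)
    · exact Or.inl (by simpa using h)
    · push Not at h
      right
      simp only [Set.mem_ofPred_eq] at hx ⊢
      rw [← Real.exp_sum, ← Finset.mul_sum, Finset.sum_congr rfl fun i _ => min_eq_left (h i)]
      gcongr
  have hU : P (⋃ i, Function.eval i ⁻¹' {y | a < f y}) ≤ n * μ {y | a < f y} := by
    refine (measure_iUnion_fintype_le _ _).trans (le_of_eq ?_)
    have : ∀ i : Fin n, P (Function.eval i ⁻¹' {y | a < f y}) = μ {y | a < f y} := fun i =>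
      (measurePreserving_eval (fun _ : Fin n => μ) i).measure_preimage
        (measurableSet_lt measurable_const hf).nullMeasurableSet
    rw [Finset.sum_congr rfl fun i _ => this i]
    simp
  have hint : Integrable (fun x : Fin n → E => ∏ i, Real.exp (l * min (f (x i)) a)) P :=
    Integrable.fintype_prod fun _ => integrable_exp_mul_min hf hl a
  have hM := mul_meas_ge_le_integral_of_nonneg
    (ae_of_all P fun x => Finset.prod_nonneg fun i _ => (Real.exp_pos _).le) hint
    (Real.exp (l * (n * (m + ε))))
  have hpow : ∫ x, ∏ i, Real.exp (l * min (f (x i)) a) ∂P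
      ≤ Real.exp (n * (l * m + l ^ r * Real.exp (l * a) * C)) := by
    rw [integral_fintype_prod_eq_pow (fun y => Real.exp (l * min (f y) a)), Fintype.card_fin,
      Real.exp_nat_mul]
    gcongr
    exact integral_exp_mul_min_le hr1 hr2 hf hfi hfr hl ha
  refine (measure_mono hsub).trans ((measure_union_le _ _).trans (add_le_add hU ?_))
  rw [← ofReal_measureReal]
  refine ENNReal.ofReal_le_ofReal ?_
  rw [← mul_le_mul_iff_right₀ (Real.exp_pos (l * (n * (m + ε)))), ← Real.exp_add]
  refine hM.trans (hpow.trans (le_of_eq ?_))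
  congr 1
  ring

theorem tendsto_rpow_mul_measure_lt {q η : ℝ} (hq : 0 < q) (hη : 0 < η) (hf : Measurable f)
    (hfq : Integrable (fun x => |f x| ^ q) μ) :
    Tendsto (fun n : ℕ => (n : ℝ≥0∞) ^ q * μ {y | η * n < f y}) atTop (𝓝 0) := by
  have key : Tendsto (fun n : ℕ => ENNReal.ofReal (η ^ (-q)) *
      ∫⁻ x in {y | η * n < f y}, ENNReal.ofReal (|f x| ^ q) ∂μ) atTop (𝓝 0) := by
    have h0 : Tendsto (fun n : ℕ => μ {y | η * n < f y}) atTop (𝓝 0) := by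
      have := tendsto_measure_iInter_atTop (μ := μ) (s := fun n : ℕ => {y | η * n < f y})
        (fun n => (measurableSet_lt measurable_const hf).nullMeasurableSet)
        (fun i j hij y (hy : η * j < f y) => by
          have : (i : ℝ) ≤ j := by exact_mod_cast hij
          exact lt_of_le_of_lt (by gcongr) hy) ⟨0, measure_ne_top _ _⟩
      have he : (⋂ n : ℕ, {y | η * n < f y}) = ∅ := by
        ext y
        simp only [Set.mem_iInter, Set.mem_ofPred_eq, Set.mem_empty_iff_false, iff_false, not_forall,
          not_lt]
        obtain ⟨n, hn⟩ := exists_nat_ge (f y / η)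
        exact ⟨n, by rwa [div_le_iff₀' hη] at hn⟩
      rwa [he, measure_empty] at this
    have h1 := tendsto_setLIntegral_zero (f := fun x => ENNReal.ofReal (|f x| ^ q)) (μ := μ)
      hfq.lintegral_lt_top.ne h0
    simpa using ENNReal.Tendsto.const_mul h1 (Or.inr ENNReal.ofReal_ne_top)
  refine tendsto_of_tendsto_of_tendsto_of_le_of_le tendsto_const_nhds key (fun _ => zero_le)
    fun n => ?_
  have hn : (n : ℝ≥0∞) ^ q = ENNReal.ofReal (η ^ (-q)) * ENNReal.ofReal ((η * n) ^ q) := by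
    rw [← ENNReal.ofReal_mul (by positivity), Real.mul_rpow hη.le (by positivity), ← mul_assoc,
      ← Real.rpow_add hη, neg_add_cancel, Real.rpow_zero, one_mul,
      ← ENNReal.ofReal_rpow_of_nonneg (by positivity) hq.le, ENNReal.ofReal_natCast]
  simp only
  rw [hn, mul_assoc]
  gcongr
  rw [← setLIntegral_const]
  refine setLIntegral_mono' (measurableSet_lt measurable_const hf) fun x hx => ?_
  gcongr
  exact (le_of_lt hx).trans (le_abs_self _)

theorem tendsto_rpow_mul_exp_log {q r K ε η C : ℝ} (hr : 1 < r) (hKε : K * ε = q)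
    (hKη : K * η = (r - 1) / 2) (hK : 0 < K) :
    Tendsto (fun n : ℕ => (n : ℝ) ^ (q - 1) *
      Real.exp (n * ((K * Real.log n / n) ^ r * Real.exp (K * Real.log n / n * (η * n)) * C)
        - K * Real.log n / n * n * ε)) atTop (𝓝 0) := by
  have hlo : Tendsto (fun x : ℝ => Real.log x ^ r / x ^ ((r - 1) / 2)) atTop (𝓝 0) :=
    (isLittleO_log_rpow_rpow_atTop r (by linarith)).tendsto_div_nhds_zero
  have h1 : Tendsto (fun x : ℝ => x⁻¹ *
      Real.exp (K ^ r * C * (Real.log x ^ r / x ^ ((r - 1) / 2)))) atTop (𝓝 0) := by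
    simpa using tendsto_inv_atTop_zero.mul
      ((Real.continuous_exp.tendsto _).comp (hlo.const_mul (K ^ r * C)))
  refine (h1.comp tendsto_natCast_atTop_atTop).congr' ?_
  filter_upwards [eventually_ge_atTop 1] with n hn
  have hn1 : (1 : ℝ) ≤ n := by exact_mod_cast hn
  have hx : (0 : ℝ) < n := by linarith
  have hlog : 0 ≤ Real.log n := Real.log_nonneg hn1
  simp only [Function.comp_apply]
  generalize (n : ℝ) = x at *
  have e1 : K * Real.log x / x * (η * x) = Real.log x * ((r - 1) / 2) := by
    rw [← hKη]; field_simp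
  have e2 : K * Real.log x / x * x * ε = Real.log x * q := by
    rw [← hKε]; field_simp
  have e3 : x * ((K * Real.log x / x) ^ r * Real.exp (K * Real.log x / x * (η * x)) * C)
      = K ^ r * C * (Real.log x ^ r / x ^ ((r - 1) / 2)) := by
    rw [e1, ← Real.rpow_def_of_pos hx, Real.div_rpow (by positivity) hx.le,
      Real.mul_rpow hK.le hlog]
    have : x ^ r = x * (x ^ ((r - 1) / 2) * x ^ ((r - 1) / 2)) := by
      rw [← Real.rpow_add hx, ← Real.rpow_one_add' hx.le (by linarith)]
      ring_nf
    rw [this]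
    have := Real.rpow_pos_of_pos hx ((r - 1) / 2)
    field_simp
  rw [e3, e2, Real.exp_sub, ← Real.rpow_def_of_pos hx, Real.rpow_sub hx, Real.rpow_one]
  have := Real.rpow_pos_of_pos hx q
  field_simp

theorem tendsto_rpow_mul_pi_sum_ge {q ε : ℝ} (hq : 1 < q) (hε : 0 < ε) (hf : Measurable f)
    (hfq : MemLp f (ENNReal.ofReal q) μ) :
    Tendsto (fun n : ℕ => (n : ℝ≥0∞) ^ (q - 1) *
      Measure.pi (fun _ : Fin n => μ) {x | n * ((∫ y, f y ∂μ) + ε) ≤ ∑ i, f (x i)})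
      atTop (𝓝 0) := by
  have hint : ∀ s : ℝ, 1 ≤ s → s ≤ q → Integrable (fun x => |f x| ^ s) μ := fun s hs hsq => by
    have := (hfq.mono_exponent (ENNReal.ofReal_le_ofReal hsq)).integrable_norm_rpow
      (by simpa using by linarith) ENNReal.ofReal_ne_top
    simpa [ENNReal.toReal_ofReal (zero_le_one.trans hs)] using this
  have hfi : Integrable f μ := hfq.integrable (by simpa using hq.le)
  set r := min q 2
  have hr1 : 1 < r := lt_min hq (by norm_num)
  have hfr := hint r hr1.le (min_le_left _ _)
  set K := q / ε
  have hK : 0 < K := by positivity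
  set η := (r - 1) / 2 / K
  have hη : 0 < η := div_pos (by linarith) hK
  have hA := tendsto_rpow_mul_measure_lt (by linarith) hη hf (hint q hq.le le_rfl)
  have hB := ENNReal.tendsto_ofReal (tendsto_rpow_mul_exp_log (q := q) (ε := ε) (η := η)
    (C := ∫ x, |f x| ^ r ∂μ) hr1 (div_mul_cancel₀ q hε.ne') (mul_div_cancel₀ _ hK.ne') hK)
  have hAB := hA.add hB
  rw [ENNReal.ofReal_zero, add_zero] at hAB
  refine tendsto_of_tendsto_of_tendsto_of_le_of_le' tendsto_const_nhds hAB
    (Eventually.of_forall fun _ => zero_le) ?_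
  filter_upwards [eventually_ge_atTop 1] with n hn
  have hn1 : (1 : ℝ) ≤ n := by exact_mod_cast hn
  have hn0 : (n : ℝ≥0∞) ≠ 0 := by simp; omega
  have hlog : 0 ≤ Real.log n := Real.log_nonneg hn1
  refine (mul_le_mul_right (pi_sum_ge_le (l := K * Real.log n / n) (a := η * n) hr1.le
    (min_le_right _ _) hf hfi hfr (by positivity) (by positivity) n) _).trans (le_of_eq ?_)
  rw [mul_add]
  congr 1
  · rw [← mul_assoc]
    congr 1
    nth_rw 2 [← ENNReal.rpow_one (n : ℝ≥0∞)]
    rw [← ENNReal.rpow_add _ _ hn0 (ENNReal.natCast_ne_top n), sub_add_cancel]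
  · rw [ENNReal.ofReal_mul (by positivity),
      ← ENNReal.ofReal_rpow_of_nonneg (by positivity) (by linarith), ENNReal.ofReal_natCast]

end

/-- The sets `U` whose complements have `μ^n(L_n ∉ U) = o(n^{1-q})`. -/
def deviationFilter {E : Type*} [TopologicalSpace E] [MeasurableSpace E] [BorelSpace E]
    {ψ : E → ℝ≥0} (hψ : Continuous ψ) (μ : Measure E) (q : ℝ) : Filter (PsiProb ψ) where
  sets := {U | Tendsto (fun n : ℕ => ((n + 1 : ℕ) : ℝ≥0∞) ^ (q - 1) *
    Measure.pi (fun _ : Fin (n + 1) => μ) {x | L hψ (n + 1) x ∈ Uᶜ}) atTop (𝓝 0)}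
  univ_sets := by simp
  sets_of_superset {U V} hU hUV := by
    refine tendsto_of_tendsto_of_tendsto_of_le_of_le tendsto_const_nhds hU (fun _ => zero_le)
      fun n => mul_le_mul_right (measure_mono fun x hx => ?_) _
    exact fun h => hx (hUV h)
  inter_sets {U V} hU hV := by
    have hUV := Tendsto.add hU hV
    rw [add_zero] at hUV
    refine tendsto_of_tendsto_of_tendsto_of_le_of_le tendsto_const_nhds hUV (fun _ => zero_le)
      fun n => ?_
    simp only
    rw [← mul_add]
    refine mul_le_mul_right ((measure_mono fun x hx => ?_).trans (measure_union_le _ _)) _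
    by_cases h : L hψ (n + 1) x ∈ U
    · exact Or.inr fun h' => hx ⟨h, h'⟩
    · exact Or.inl h

theorem densityNorm_self_le_one {E : Type*} [MeasurableSpace E] {μ : Measure E}
    [IsProbabilityMeasure μ] (p : ℝ) : densityNorm p μ μ ≤ 1 := by
  rw [densityNorm, if_pos Measure.AbsolutelyContinuous.rfl, eLpNorm_congr_ae μ.rnDeriv_self]
  rcases eq_or_ne (ENNReal.ofReal p) 0 with h | h
  · simp [h]
  · rw [eLpNorm_const _ h (IsProbabilityMeasure.ne_zero μ)]
    simp

variable {E : Type*} [TopologicalSpace E] [MeasurableSpace E] [BorelSpace E] {μ : Measure E}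
  [IsProbabilityMeasure μ] {ψ : E → ℝ≥0}

theorem integral_L (hψ : Continuous ψ) (n : ℕ) [NeZero n] (x : Fin n → E) {f : E → ℝ}
    (hf : Continuous f) : ∫ y, f y ∂(L hψ n x).toMeasure = (n : ℝ)⁻¹ * ∑ i, f (x i) := by
  have hd : ∀ i, Integrable f (Measure.dirac (x i)) := fun i =>
    integrable_dirac' hf.measurable.stronglyMeasurable enorm_lt_top
  change ∫ y, f y ∂(empiricalMeasure n x) = _
  rw [empiricalMeasure, integral_smul_measure, integral_finsetSum_measure fun i _ => hd i]
  simp [integral_dirac' _ _ hf.measurable.stronglyMeasurable]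

theorem memLp_of_abs_le_one_add {q : ℝ} (hq : 0 < q) (hψ : Continuous ψ)
    (hint : ∫⁻ x, (ψ x : ℝ≥0∞) ^ q ∂μ < ∞) {f : E → ℝ} (hf : Continuous f)
    (hfψ : ∀ x, |f x| ≤ 1 + (ψ x : ℝ)) : MemLp f (ENNReal.ofReal q) μ := by
  have hψq : MemLp (fun x => (ψ x : ℝ)) (ENNReal.ofReal q) μ := by
    refine ⟨(NNReal.continuous_coe.comp hψ).measurable.aestronglyMeasurable, ?_⟩
    rw [eLpNorm_lt_top_iff_lintegral_rpow_enorm_lt_top (by simpa using hq) ENNReal.ofReal_ne_top,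
      ENNReal.toReal_ofReal hq.le]
    simpa using hint
  refine ((memLp_const (1 : ℝ)).add hψq).mono hf.measurable.aestronglyMeasurable
    (ae_of_all _ fun x => ?_)
  exact (hfψ x).trans (le_abs_self _)

theorem deviationFilter_le_nhds {q : ℝ} (hq : 1 < q) (hψ : Continuous ψ)
    (hint : ∫⁻ x, (ψ x : ℝ≥0∞) ^ q ∂μ < ∞) {ν : PsiProb ψ} (hν : ν.toMeasure = μ) :
    deviationFilter hψ μ q ≤ 𝓝 ν := by
  rw [nhds_iInf]
  refine le_iInf fun f => ?_
  rw [nhds_induced, ← tendsto_iff_comap]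
  simp only [hν]
  have upper : ∀ {g : E → ℝ}, Continuous g → (∀ x, |g x| ≤ 1 + (ψ x : ℝ)) → ∀ ε > 0,
      ∀ᶠ κ in deviationFilter hψ μ q, ∫ y, g y ∂κ.toMeasure < (∫ y, g y ∂μ) + ε := by
    intro g hg hgψ ε hε
    have h := (tendsto_rpow_mul_pi_sum_ge hq hε hg.measurable
      (memLp_of_abs_le_one_add (zero_lt_one.trans hq) hψ hint hg hgψ)).comp
      (tendsto_add_atTop_nat 1)
    refine h.congr fun n => ?_
    simp only [Function.comp_apply]
    congr 2
    ext x
    have hn : (0 : ℝ) < ((n + 1 : ℕ) : ℝ) := by positivity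
    simp only [Set.mem_ofPred_eq, Set.mem_compl_iff, not_lt, integral_L hψ _ x hg]
    exact (le_inv_mul_iff₀ hn).symm
  rw [Metric.tendsto_nhds]
  intro ε hε
  filter_upwards [upper f.2.1 f.2.2 ε hε,
    upper f.2.1.neg (fun x => by simpa using f.2.2 x) ε hε] with κ h1 h2
  simp only [Pi.neg_apply, integral_neg] at h2
  rw [Real.dist_eq, abs_lt]
  constructor <;> linarith

end HeavySanov

theorem theorem1p2 {E : Type*} [TopologicalSpace E] [PolishSpace E]
    [MeasurableSpace E] [BorelSpace E]
    (p q : ℝ) (hp : 1 < p) (hq : q = p / (p - 1))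
    (μ : Measure E) [IsProbabilityMeasure μ]
    (ψ : E → ℝ≥0) (hψ : Continuous ψ)
    (hint : ∫⁻ x, (ψ x : ℝ≥0∞) ^ q ∂μ < ∞)
    (A : Set (HeavySanov.PsiProb ψ)) (hA : IsClosed A) :
    limsup (fun n : ℕ =>
        ((n + 1 : ℕ) : ℝ≥0∞) ^ (1 / p) *
          (Measure.pi (fun _ : Fin (n + 1) => μ)
            {x | HeavySanov.L hψ (n + 1) x ∈ A}) ^ (1 / q)) atTop
      ≤ ((⨅ ν ∈ A, HeavySanov.densityNorm p ν.toMeasure μ) - 1)⁻¹ := by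
  have hp1 : 0 < p - 1 := by linarith
  have hq1 : 1 < q := by rw [hq, lt_div_iff₀ hp1]; linarith
  have hψ1 : ∫⁻ x, (ψ x : ℝ≥0∞) ∂μ < ∞ := by
    have := ((HeavySanov.memLp_of_abs_le_one_add (zero_lt_one.trans hq1) hψ hint
      (NNReal.continuous_coe.comp hψ) fun x => by simp).integrable
      (by simpa using hq1.le)).hasFiniteIntegral
    simpa [HasFiniteIntegral] using this
  let ν₀ : HeavySanov.PsiProb ψ := ⟨⟨μ, inferInstance⟩, hψ1⟩
  by_cases h : ν₀ ∈ A
  · have hle : (⨅ ν ∈ A, HeavySanov.densityNorm p ν.toMeasure μ) ≤ 1 :=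
      (iInf₂_le ν₀ h).trans (HeavySanov.densityNorm_self_le_one (μ := μ) p)
    simp [tsub_eq_zero_of_le hle]
  · have ht : Tendsto (fun n : ℕ => ((n + 1 : ℕ) : ℝ≥0∞) ^ (q - 1) *
        Measure.pi (fun _ : Fin (n + 1) => μ) {x | HeavySanov.L hψ (n + 1) x ∈ Aᶜᶜ})
        atTop (𝓝 0) :=
      HeavySanov.deviationFilter_le_nhds hq1 hψ hint rfl (hA.isOpen_compl.mem_nhds h)
    have ht' := (ENNReal.continuous_rpow_const (y := 1 / q)).continuousAt.tendsto.comp ht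
    rw [ENNReal.zero_rpow_of_pos (by positivity)] at ht'
    refine le_of_eq_of_le (Tendsto.limsup_eq (ht'.congr fun n => ?_)) zero_le
    have hpq : (q - 1) * (1 / q) = 1 / p := by
      rw [hq]
      field_simp
      ring
    simp only [Function.comp_apply, compl_compl]
    rw [ENNReal.mul_rpow_of_nonneg _ _ (by positivity), ← ENNReal.rpow_mul, hpq]
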